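/- Let $\alpha,\beta>0$ and $\rho:=\log_2(\alpha+\beta)$. Let $\varphi:[0,1]\to[0,1]$ be the unique continuous function with $\varphi(0)=0$, $\varphi(1)=1$, $\varphi(t)=\frac{\beta}{\alpha+\beta}\varphi(2t)$ for $0\le t\le\frac12$ and $\varphi(t)=\frac{\alpha}{\alpha+\beta}\varphi(2t-1)+\frac{\beta}{\alpha+\beta}$ for $\frac12\le t\le1$. Let the real sequences $f(n)$ $(n\ge1)$ and $g(n)$ $(n\ge2)$ satisfy $$f(n)=\alpha f(\lfloor n/2\rfloor)+\beta f(\lceil n/2\rceil)+g(n),\qquad n\ge2,$$ put $g(1):=0$, and extend $g$ to a function on $[0,\infty)$ by $g(n+t):=g(n)+\varphi(t)(g(n+1)-g(n))$ for integers $n\ge1$ and $0\le t\le1$, and $g(x):=0$ for $0\le x<1$. Let $g^*(s):=\int_0^\infty g(x)x^{s-1}\,dx$ denote the Mellin transform of $g$ and also its meromorphic continuation, and let $\chi_k:=2k\pi i/\log 2$ for $k\in\mathbb{Z}$. **Theorem.** Assume that $g(n)=n^\rho+g_0(n)$ for $n\ge2$, where $g_0(n)=O(n^{\rho-\varepsilon})$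 as $n\to\infty$, for some $\varepsilon>0$. Then there are a continuous $1$-periodic function $P:\mathbb{R}\to\mathbb{R}$ and a sequence $Q(n)=o(n^\rho)$ such that $$f(n)=n^\rho\log_2 n+n^\rho P(\log_2 n)-Q(n),\qquad n\ge1.$$ The integral $g^*(s)$ converges absolutely for $\operatorname{Re}s<-\rho$ and extends to a meromorphic function in $\operatorname{Re}s<-\rho+\min(\varepsilon,1)$, whose only pole there is a simple pole at $s=-\rho$. The Fourier coefficients $\widehat P(k)=\int_0^1P(t)e^{-2k\pi it}\,dt$ are, for $k\in\mathbb{Z}$, $$\widehat P(k)=\frac{f(1)}{\log2}\int_0^1\frac{1+(\alpha+\beta-1)\varphi(u)}{(1+u)^{\rho+\chi_k+1}}\,du+\begin{cases}\frac1{\log2}\,g^*(-\rho-\chi_k),&k\ne0,\\[2pt] \frac1{\log2}\,\mathrm{FV}[g^*;-\rho]+\frac12,&k=0,\end{cases}$$ where $\mathrm{FV}[g^*;-\rho]$ is the constant term of the Laurent expansion of $g^*$ at $-\rho$. In particular, for $k\ne0$, $$\widehat P(k)=\lim_{\delta\downarrow0}\frac1{\log2}\int_1^\infty\frac{g(u)}{u^{\rho+\chi_k+1+\delta}}\,du+\frac{f(1)}{\log2}\int_0^1\frac{1+(\alpha+\beta-1)\varphi(u)}{(1+u)^{\rho+\chi_k+1}}\,du.$$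 If, moreover, $g(n)=n^\rho$ for all even $n\ge2$, then $Q(n)=0$ for all $n\ge1$. -/

import Mathlib

open Set Filter Topology MeasureTheory Asymptotics

namespace DivConq

noncomputable section

/-- Successive approximations to the interpolation function: start from the identity and
repeatedly glue two scaled copies. Only the values on `[0, 1]` matter. -/
def phiIter (a b : ℝ) : ℕ → ℝ → ℝ
  | 0, t => t
  | k + 1, t =>
      if t ≤ 1 / 2 then b / (a + b) * phiIter a b k (2 * t)
      else a / (a + b) * phiIter a b k (2 * t - 1) + b / (a + b)

/-- The interpolation function `φ = φ_{α,β}` on `[0, 1]`, the limit of `phiIter`.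
By `phi_spec` and `phi_unique` below it is, for `α, β > 0`, the unique continuous function on
`[0, 1]` with `φ 0 = 0`, `φ 1 = 1` satisfying the two-scale equations. -/
def phi (a b : ℝ) (t : ℝ) : ℝ :=
  limUnder atTop (fun k : ℕ => phiIter a b k t)

/-- The characterisation of `φ_{α,β}`: a continuous solution on `[0, 1]` of the two-scale
equations, with boundary values `0` and `1`. -/
structure IsInterpolator (a b : ℝ) (φ : ℝ → ℝ) : Prop where
  continuousOn : ContinuousOn φ (Icc 0 1)
  zero : φ 0 = 0
  one : φ 1 = 1
  left : ∀ t ∈ Icc (0 : ℝ) (1 / 2), φ t = b / (a + b) * φ (2 * t)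
  right : ∀ t ∈ Icc (1 / 2 : ℝ) 1, φ t = a / (a + b) * φ (2 * t - 1) + b / (a + b)

theorem phiIter_zero (a b : ℝ) (k : ℕ) : phiIter a b k 0 = 0 := by
  induction k with
  | zero => simp [phiIter]
  | succ k ih => simp [phiIter, ih]

theorem phiIter_one {a b : ℝ} (ha : 0 < a) (hb : 0 < b) (k : ℕ) : phiIter a b k 1 = 1 := by
  induction k with
  | zero => simp [phiIter]
  | succ k ih =>
    have h : a + b ≠ 0 := by positivity
    have h2 : ¬ ((1 : ℝ) ≤ 1 / 2) := by norm_num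
    have h3 : (2 * 1 - 1 : ℝ) = 1 := by norm_num
    simp only [phiIter, h2, if_false, h3, ih]
    field_simp

theorem phiIter_continuous {a b : ℝ} (ha : 0 < a) (hb : 0 < b) (k : ℕ) :
    Continuous (phiIter a b k) := by
  induction k with
  | zero => exact continuous_id
  | succ k ih =>
    have h : phiIter a b (k + 1) = fun t =>
      if t ≤ 1 / 2 then b / (a + b) * phiIter a b k (2 * t)
      else a / (a + b) * phiIter a b k (2 * t - 1) + b / (a + b) := rfl
    rw [h]
    refine Continuous.if_le (by fun_prop) (by fun_prop) continuous_id continuous_const ?_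
    rintro t rfl
    norm_num [phiIter_zero, phiIter_one ha hb]

theorem phiIter_right {a b : ℝ} (ha : 0 < a) (hb : 0 < b) (k : ℕ) {t : ℝ} (ht : 1 / 2 ≤ t) :
    phiIter a b (k + 1) t = a / (a + b) * phiIter a b k (2 * t - 1) + b / (a + b) := by
  rcases ht.eq_or_lt with rfl | h
  · norm_num [phiIter, phiIter_zero, phiIter_one ha hb]
  · rw [phiIter, if_neg (not_le.2 h)]

theorem phiIter_dist {a b : ℝ} (ha : 0 < a) (hb : 0 < b) (k : ℕ) :
    ∀ t ∈ Icc (0 : ℝ) 1,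
      dist (phiIter a b k t) (phiIter a b (k + 1) t) ≤ 1 * (max a b / (a + b)) ^ k := by
  have hab : 0 < a + b := by positivity
  have h1 : a / (a + b) ≤ max a b / (a + b) := by gcongr; exact le_max_left _ _
  have h2 : b / (a + b) ≤ max a b / (a + b) := by gcongr; exact le_max_right _ _
  have ha' : 0 < a / (a + b) := by positivity
  have hb' : 0 < b / (a + b) := by positivity
  have hs : a / (a + b) + b / (a + b) = 1 := by field_simp
  induction k with
  | zero =>
    rintro t ⟨h0, h1⟩
    rw [Real.dist_eq, pow_zero, one_mul, abs_le]
    by_cases h : t ≤ 1 / 2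
    · simp only [phiIter, h, if_true]
      constructor <;> nlinarith
    · simp only [phiIter, h, if_false]
      push Not at h
      constructor <;> nlinarith
  | succ k ih =>
    rintro t ⟨h0, h1'⟩
    have hp : 0 ≤ 1 * (max a b / (a + b)) ^ k := by positivity
    have e : 1 * (max a b / (a + b)) ^ (k + 1)
        = max a b / (a + b) * (1 * (max a b / (a + b)) ^ k) := by ring
    rw [e, Real.dist_eq]
    by_cases h : t ≤ 1 / 2
    · have := ih (2 * t) ⟨by linarith, by linarith⟩
      rw [Real.dist_eq] at this
      rw [phiIter, phiIter, if_pos h, if_pos h, ← mul_sub, abs_mul, abs_of_pos hb']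
      gcongr
    · push Not at h
      have := ih (2 * t - 1) ⟨by linarith, by linarith⟩
      rw [Real.dist_eq] at this
      rw [phiIter, phiIter, if_neg (not_le.2 h), if_neg (not_le.2 h), add_sub_add_right_eq_sub,
        ← mul_sub, abs_mul, abs_of_pos ha']
      gcongr

theorem ratio_lt_one {a b : ℝ} (ha : 0 < a) (hb : 0 < b) : max a b / (a + b) < 1 := by
  rw [div_lt_one (by positivity)]
  exact max_lt (by linarith) (by linarith)

theorem phi_tendsto {a b : ℝ} (ha : 0 < a) (hb : 0 < b) {t : ℝ} (ht : t ∈ Icc (0 : ℝ) 1) :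
    Tendsto (fun k : ℕ => phiIter a b k t) atTop (𝓝 (phi a b t)) :=
  (cauchySeq_of_le_geometric _ 1 (ratio_lt_one ha hb)
    (fun k => phiIter_dist ha hb k t ht)).tendsto_limUnder

theorem phi_spec {a b : ℝ} (ha : 0 < a) (hb : 0 < b) : IsInterpolator a b (phi a b) where
  continuousOn := by
    have hr := ratio_lt_one ha hb
    have hr0 : 0 ≤ max a b / (a + b) := by positivity
    have hu : TendstoUniformlyOn (phiIter a b) (phi a b) atTop (Icc 0 1) := by
      rw [Metric.tendstoUniformlyOn_iff]
      intro ε hε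
      have hlim : Tendsto (fun k : ℕ => 1 * (max a b / (a + b)) ^ k / (1 - max a b / (a + b)))
          atTop (𝓝 0) := by
        simpa using ((tendsto_pow_atTop_nhds_zero_of_lt_one hr0 hr).const_mul 1).div_const
          (1 - max a b / (a + b))
      filter_upwards [hlim.eventually (gt_mem_nhds hε)] with k hk t ht
      rw [dist_comm]
      exact (dist_le_of_le_geometric_of_tendsto _ 1 hr (fun k => phiIter_dist ha hb k t ht)
        (phi_tendsto ha hb ht) k).trans_lt hk
    exact hu.continuousOn (Frequently.of_forall fun k => (phiIter_continuous ha hb k).continuousOn)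
  zero := by
    refine tendsto_nhds_unique (phi_tendsto ha hb (by simp)) ?_
    simp [phiIter_zero]
  one := by
    refine tendsto_nhds_unique (phi_tendsto ha hb (by simp)) ?_
    simp [phiIter_one ha hb]
  left := by
    rintro t ⟨h0, h1⟩
    have h := (phi_tendsto ha hb (t := t) ⟨h0, by linarith⟩).comp (tendsto_add_atTop_nat 1)
    refine tendsto_nhds_unique h ?_
    refine ((phi_tendsto ha hb (t := 2 * t) ⟨by linarith, by linarith⟩).const_mul
      (b / (a + b))).congr fun k => ?_
    simp only [Function.comp, phiIter, if_pos h1]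
  right := by
    rintro t ⟨h0, h1⟩
    have h := (phi_tendsto ha hb (t := t) ⟨by linarith, h1⟩).comp (tendsto_add_atTop_nat 1)
    refine tendsto_nhds_unique h ?_
    refine (((phi_tendsto ha hb (t := 2 * t - 1) ⟨by linarith, by linarith⟩).const_mul
      (a / (a + b))).add_const (b / (a + b))).congr fun k => ?_
    simp only [Function.comp, phiIter_right ha hb k h0]

theorem phi_unique {a b : ℝ} (ha : 0 < a) (hb : 0 < b) {φ : ℝ → ℝ}
    (hφ : IsInterpolator a b φ) : EqOn φ (phi a b) (Icc 0 1) := by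
  have hp := phi_spec ha hb
  have hr := ratio_lt_one ha hb
  have hr0 : 0 ≤ max a b / (a + b) := by positivity
  have h1 : a / (a + b) ≤ max a b / (a + b) := by gcongr; exact le_max_left _ _
  have h2 : b / (a + b) ≤ max a b / (a + b) := by gcongr; exact le_max_right _ _
  have ha' : 0 < a / (a + b) := by positivity
  have hb' : 0 < b / (a + b) := by positivity
  obtain ⟨M, hM⟩ := isCompact_Icc.exists_bound_of_continuousOn
    (hφ.continuousOn.sub hp.continuousOn)
  have key : ∀ k : ℕ, ∀ t ∈ Icc (0 : ℝ) 1,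
      |φ t - phi a b t| ≤ (max a b / (a + b)) ^ k * M := by
    intro k
    induction k with
    | zero => intro t ht; simpa using hM t ht
    | succ k ih =>
      rintro t ⟨h0, h1'⟩
      rw [pow_succ', mul_assoc]
      rcases le_total t (1 / 2) with h | h
      · rw [hφ.left t ⟨h0, h⟩, hp.left t ⟨h0, h⟩, ← mul_sub, abs_mul, abs_of_pos hb']
        have := ih (2 * t) ⟨by linarith, by linarith⟩
        gcongr
      · rw [hφ.right t ⟨h, h1'⟩, hp.right t ⟨h, h1'⟩, add_sub_add_right_eq_sub, ← mul_sub,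
          abs_mul, abs_of_pos ha']
        have := ih (2 * t - 1) ⟨by linarith, by linarith⟩
        gcongr
  intro t ht
  have hlim : Tendsto (fun k : ℕ => (max a b / (a + b)) ^ k * M) atTop (𝓝 0) := by
    simpa using (tendsto_pow_atTop_nhds_zero_of_lt_one hr0 hr).mul_const M
  have h0 : |φ t - phi a b t| ≤ 0 := ge_of_tendsto' hlim fun k => key k t ht
  exact sub_eq_zero.1 (abs_nonpos_iff.1 h0)

/-- The operator `Λ_{α,β}[f](n) = f(n) - α f(⌊n/2⌋) - β f(⌈n/2⌉)`. -/
def Lam (a b : ℝ) (f : ℕ → ℝ) (n : ℕ) : ℝ :=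
  f n - a * f (n / 2) - b * f ((n + 1) / 2)

/-- The exponent `ρ = log₂ (α + β)`. -/
def rho (a b : ℝ) : ℝ := Real.logb 2 (a + b)

/-- The extension of a sequence `h(1), h(2), …` to a function on `[0, ∞)`: interpolation by `φ`
between consecutive integers on `[1, ∞)`, and `0` on `[0, 1)`. -/
def extend (a b : ℝ) (h : ℕ → ℝ) (x : ℝ) : ℝ :=
  if x < 1 then 0
  else h ⌊x⌋₊ + phi a b (x - ⌊x⌋₊) * (h (⌊x⌋₊ + 1) - h ⌊x⌋₊)

/-- `χ_k = 2 k π i / log 2`. -/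
def chi (k : ℤ) : ℂ := 2 * k * Real.pi / Real.log 2 * Complex.I

/-- The Fourier coefficient `∫₀¹ P(t) e^{-2 k π i t} dt`. -/
def fourierCoef (P : ℝ → ℝ) (k : ℤ) : ℂ :=
  ∫ t in (0 : ℝ)..1, (P t : ℂ) * Complex.exp (-2 * k * Real.pi * Complex.I * t)

/-- `F` has a (finite-order) Laurent expansion at `s`, and `c` is its constant term:
near `s`, off `s`, `F` is a polynomial in `(z - s)⁻¹` without constant term, plus a function
analytic at `s` whose value there is `c`. -/
def HasFiniteValue (F : ℂ → ℂ) (s c : ℂ) : Prop :=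
  ∃ (p : Polynomial ℂ) (h : ℂ → ℂ), p.coeff 0 = 0 ∧ AnalyticAt ℂ h s ∧ h s = c ∧
    ∀ᶠ z in 𝓝[≠] s, F z = p.eval (z - s)⁻¹ + h z

/-- The integral `∫₀¹ (1 + (α + β - 1) φ(u)) / (1 + u)^{ρ + χ_k + 1} du`. -/
def initialIntegral (a b : ℝ) (k : ℤ) : ℂ :=
  ∫ u in (0 : ℝ)..1, ((1 + (a + b - 1) * phi a b u : ℝ) : ℂ) /
    ((1 + u : ℝ) : ℂ) ^ ((rho a b : ℂ) + chi k + 1)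

/-- `G` is a meromorphic continuation to the half-plane `Re s < c` of the Mellin transform of
`u`, which converges absolutely (at least) for `Re s < d`. -/
structure IsMellinContinuation (u : ℝ → ℝ) (d c : ℝ) (G : ℂ → ℂ) : Prop where
  eq_mellin : ∀ s : ℂ, s.re < d →
    MellinConvergent (fun x => (u x : ℂ)) s ∧ G s = mellin (fun x => (u x : ℂ)) s
  meromorphicOn : MeromorphicOn G {s : ℂ | s.re < c}

end

end DivConq

/-!
Interpolating by `φ` turns the recurrence for `f` into the functional equation
`F(x) = (α + β) F(x / 2) + G(x)`, valid at every real `x ≥ 2` (`extend_two_mul`), where `F` and `G`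
are the extensions of `f` and `g`. The assumption on `g` gives `G(x) = x^ρ (1 + w(x))` for `x ≥ 1`
with `w` continuous and `w(x) = O(x^{-θ})`, `θ = min(ε, 1)` (`exists_abs_extend_sub_rpow_le`).

Let `S(x) = ∑_{j ≥ 0} w(2^j x)`, so that `w(x) = S(x) - S(2x)`. As `2^ρ = α + β`, doubling `x` adds
`1 + w(2x)` to `x^{-ρ} F(x)`; hence `p(x) = x^{-ρ} F(x) - log₂ x + S(2x)` satisfies `p(2x) = p(x)`
on `[1, ∞)` (`profile_two_mul`). So `P(t) = p(2^{t - ⌊t⌋})` is continuous and `1`-periodic, and the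
formula for `f` holds with `Q(n) = n^ρ S(2n)`. This is `O(n^{ρ-θ})`, and it involves `g` only at
even arguments, whence the last assertion of the theorem.

For the Fourier coefficients, `y = 2^t` turns `P̂(k)` into `(log 2)⁻¹ ∫₁² p(y) y^{-χ_k-1} dy`, and
on `[1, 2]` one has `p(y) = f(1) y^{-ρ} (1 + (α + β - 1) φ(y - 1)) + S(y) + (1 - log₂ y)`. The first
term gives the integral with `f(1)`. Since `2^{χ_k} = 1`, the second unfolds to
`∫₁^∞ w(y) y^{-χ_k-1} dy` (`integral_dyadicSum_mul_cpow`), which is the value at `-ρ - χ_k` of the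
Mellin transform `M` of `G(x) - x^ρ` on `[1, ∞)`, analytic in `Re s < -ρ + θ`. The transform of
`x^ρ` on `[1, ∞)` is `-1 / (s + ρ)`, so `M(s) - 1 / (s + ρ)` continues the Mellin transform of `G`.
The third term is the Fourier coefficient of `1 - t`, namely `(log 2)⁻¹ / χ_k` for `k ≠ 0`, which is
the contribution of the pole term at `-ρ - χ_k`, and `1 / 2` for `k = 0`.
-/

/-! ### Dyadic sums -/

namespace DivConq

/-- The dyadic sum `∑_{j ≥ 0} w(2^j y)`; meaningful for `y ≥ 1` when `w(y) = O(y^{-θ})`, `θ > 0`. -/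
noncomputable def dyadicSum (w : ℝ → ℝ) (y : ℝ) : ℝ := ∑' j : ℕ, w (2 ^ j * y)

section DyadicSum

variable {w : ℝ → ℝ} {C θ : ℝ}

theorem two_rpow_neg_lt_one (hθ : 0 < θ) : (2 : ℝ) ^ (-θ) < 1 :=
  Real.rpow_lt_one_of_one_lt_of_neg one_lt_two (neg_lt_zero.2 hθ)

theorem one_le_two_pow_mul {y : ℝ} (hy : 1 ≤ y) (j : ℕ) : 1 ≤ 2 ^ j * y :=
  one_le_mul_of_one_le_of_one_le (one_le_pow₀ one_le_two) hy

theorem two_pow_mul_rpow_neg {y : ℝ} (hy : 1 ≤ y) (j : ℕ) :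
    (2 ^ j * y) ^ (-θ) = y ^ (-θ) * ((2 : ℝ) ^ (-θ)) ^ j := by
  rw [Real.mul_rpow (by positivity) (by linarith), ← Real.rpow_natCast, ← Real.rpow_natCast,
    ← Real.rpow_mul two_pos.le, ← Real.rpow_mul two_pos.le, mul_comm, mul_comm (j : ℝ)]

theorem abs_dyadic_term_le (hw : ∀ y, 1 ≤ y → |w y| ≤ C * y ^ (-θ)) {y : ℝ} (hy : 1 ≤ y) (j : ℕ) :
    |w (2 ^ j * y)| ≤ C * y ^ (-θ) * ((2 : ℝ) ^ (-θ)) ^ j := by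
  rw [mul_assoc, ← two_pow_mul_rpow_neg hy]
  exact hw _ (one_le_two_pow_mul hy j)

theorem summable_geometric_two_rpow_neg (hθ : 0 < θ) : Summable fun j : ℕ => ((2 : ℝ) ^ (-θ)) ^ j :=
  summable_geometric_of_lt_one (by positivity) (two_rpow_neg_lt_one hθ)

theorem summable_dyadic (hθ : 0 < θ) (hw : ∀ y, 1 ≤ y → |w y| ≤ C * y ^ (-θ)) {y : ℝ}
    (hy : 1 ≤ y) : Summable fun j : ℕ => w (2 ^ j * y) :=
  .of_norm_bounded ((summable_geometric_two_rpow_neg hθ).mul_left _) (abs_dyadic_term_le hw hy)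

theorem dyadicSum_eq_add (hθ : 0 < θ) (hw : ∀ y, 1 ≤ y → |w y| ≤ C * y ^ (-θ)) {y : ℝ}
    (hy : 1 ≤ y) : dyadicSum w y = w y + dyadicSum w (2 * y) := by
  rw [dyadicSum, (summable_dyadic hθ hw hy).tsum_eq_zero_add, pow_zero, one_mul, dyadicSum]
  simp only [pow_succ, mul_assoc]

theorem abs_dyadicSum_le (hθ : 0 < θ) (hw : ∀ y, 1 ≤ y → |w y| ≤ C * y ^ (-θ)) {y : ℝ}
    (hy : 1 ≤ y) : |dyadicSum w y| ≤ C * (∑' j : ℕ, ((2 : ℝ) ^ (-θ)) ^ j) * y ^ (-θ) := by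
  have h := tsum_of_norm_bounded (f := fun j : ℕ => w (2 ^ j * y))
    ((summable_geometric_two_rpow_neg hθ).mul_left (C * y ^ (-θ))).hasSum
    (abs_dyadic_term_le hw hy)
  rw [tsum_mul_left, mul_right_comm] at h
  exact h

theorem continuousOn_dyadicSum (hθ : 0 < θ) (hw : ∀ y, 1 ≤ y → |w y| ≤ C * y ^ (-θ))
    (hc : ContinuousOn w (Ici 1)) : ContinuousOn (dyadicSum w) (Ici 1) := by
  have hC : 0 ≤ C := by simpa using (abs_nonneg _).trans (hw 1 le_rfl)
  refine continuousOn_tsum (u := fun j : ℕ => C * ((2 : ℝ) ^ (-θ)) ^ j) (fun j => ?_)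
    ((summable_geometric_two_rpow_neg hθ).mul_left _) fun j y hy => ?_
  · exact hc.comp (by fun_prop) fun y hy => one_le_two_pow_mul hy j
  · refine (abs_dyadic_term_le hw hy j).trans ?_
    have : y ^ (-θ) ≤ 1 := Real.rpow_le_one_of_one_le_of_nonpos hy (neg_nonpos.2 hθ.le)
    gcongr
    exact mul_le_of_le_one_right hC this

theorem continuousOn_ofReal_mul_cpow {v : ℝ → ℝ} (hv : ContinuousOn v (Ici 1)) (s : ℂ) :
    ContinuousOn (fun y : ℝ => (v y : ℂ) * (y : ℂ) ^ s) (Ici 1) := by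
  refine (Complex.continuous_ofReal.comp_continuousOn hv).mul fun y hy => ?_
  refine ContinuousAt.continuousWithinAt ?_
  exact Complex.continuousAt_ofReal_cpow_const _ _ (Or.inr (by have := mem_Ici.1 hy; linarith))

theorem integrableOn_Ioi_mul_cpow {v : ℝ → ℝ} {r : ℝ} {s : ℂ}
    (hv : ∀ y, 1 ≤ y → |v y| ≤ C * y ^ r) (hc : ContinuousOn v (Ici 1)) (hs : r + s.re < -1) :
    IntegrableOn (fun y : ℝ => (v y : ℂ) * (y : ℂ) ^ s) (Ioi 1) := by
  have h := (integrableOn_Ioi_rpow_of_lt hs one_pos).const_mul C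
  refine h.mono' (((continuousOn_ofReal_mul_cpow hc s).mono
    Ioi_subset_Ici_self).aestronglyMeasurable measurableSet_Ioi) ?_
  refine (ae_restrict_iff' measurableSet_Ioi).2 (.of_forall fun y hy => ?_)
  have hy0 : 0 < y := one_pos.trans hy
  rw [norm_mul, Complex.norm_real, Complex.norm_cpow_eq_rpow_re_of_pos hy0, Real.rpow_add hy0,
    ← mul_assoc]
  exact mul_le_mul_of_nonneg_right (hv y (le_of_lt hy)) (by positivity)

/-- Unfolding a dyadic sum against a kernel `y^{-χ-1}` invariant under `y ↦ 2y`. Since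
`w(y) = S(y) - S(2y)` for `S = dyadicSum w`, the integral of `w` over `[1, N]` telescopes to the
integral of `S` over `[1, 2]` minus the one over `[N, 2N]`, which tends to `0`. -/
theorem integral_dyadicSum_mul_cpow (hθ : 0 < θ) (hw : ∀ y, 1 ≤ y → |w y| ≤ C * y ^ (-θ))
    (hc : ContinuousOn w (Ici 1)) {χ : ℂ} (hχ : χ.re = 0) (h2 : (2 : ℂ) ^ χ = 1) :
    ∫ y in (1 : ℝ)..2, (dyadicSum w y : ℂ) * (y : ℂ) ^ (-χ - 1) =
      ∫ y in Ioi (1 : ℝ), (w y : ℂ) * (y : ℂ) ^ (-χ - 1) := by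
  set S := dyadicSum w with hS
  set K : ℝ → ℂ := fun y => (S y : ℂ) * (y : ℂ) ^ (-χ - 1) with hK
  have hSc : ContinuousOn S (Ici 1) := continuousOn_dyadicSum hθ hw hc
  have hKc : ContinuousOn K (Ici 1) := continuousOn_ofReal_mul_cpow hSc _
  have hint : ∀ {u v : ℝ}, 1 ≤ u → 1 ≤ v → IntervalIntegrable K volume u v := fun hu hv =>
    (hKc.mono fun y hy => (le_inf hu hv).trans hy.1).intervalIntegrable
  obtain ⟨D, hD⟩ : ∃ D, ∀ y, 1 ≤ y → |S y| ≤ D * y ^ (-θ) :=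
    ⟨_, fun y hy => abs_dyadicSum_le hθ hw hy⟩
  have hscale : ∀ y : ℝ, 1 ≤ y → (S (2 * y) : ℂ) * (y : ℂ) ^ (-χ - 1) = 2 * K (2 * y) := by
    intro y hy
    have : ((2 * y : ℝ) : ℂ) ^ (-χ - 1) = (2 : ℂ)⁻¹ * (y : ℂ) ^ (-χ - 1) := by
      rw [Complex.ofReal_mul, Complex.mul_cpow_ofReal_nonneg two_pos.le (by linarith),
        Complex.ofReal_ofNat, Complex.cpow_sub _ _ two_ne_zero, Complex.cpow_neg, h2,
        Complex.cpow_one]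
      simp
    rw [hK]
    simp only [this]
    ring
  have htel : ∀ N : ℝ, 1 ≤ N → ∫ y in (1 : ℝ)..N, (w y : ℂ) * (y : ℂ) ^ (-χ - 1) =
      (∫ y in (1 : ℝ)..2, K y) - ∫ y in N..(2 * N), K y := by
    intro N hN
    have e : ∫ y in (1 : ℝ)..N, (w y : ℂ) * (y : ℂ) ^ (-χ - 1) =
        ∫ y in (1 : ℝ)..N, (K y - 2 * K (2 * y)) := by
      refine intervalIntegral.integral_congr fun y hy => ?_
      rw [uIcc_of_le hN] at hy
      have := dyadicSum_eq_add hθ hw hy.1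
      rw [← hscale y hy.1, hK, ← sub_mul, ← Complex.ofReal_sub, hS, this, add_sub_cancel_right]
    have hint2 : IntervalIntegrable (fun y => 2 * K (2 * y)) volume 1 N := by
      refine ContinuousOn.intervalIntegrable ?_
      rw [uIcc_of_le hN]
      refine continuousOn_const.mul (hKc.comp (by fun_prop) fun y hy => ?_)
      have := hy.1
      simp only [mem_Ici]
      linarith
    rw [e, intervalIntegral.integral_sub (hint le_rfl hN) hint2,
      intervalIntegral.integral_const_mul,
      intervalIntegral.integral_comp_mul_left K two_ne_zero, mul_one, Complex.real_smul]
    rw [← intervalIntegral.integral_add_adjacent_intervals (hint le_rfl one_le_two)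
        (hint one_le_two hN),
      ← intervalIntegral.integral_add_adjacent_intervals (hint one_le_two hN)
        (hint hN (by linarith : 1 ≤ 2 * N))]
    push_cast
    ring
  have hKint : IntegrableOn K (Ioi 1) :=
    integrableOn_Ioi_mul_cpow hD hSc (by simp [hχ, hθ])
  have hlimK := intervalIntegral_tendsto_integral_Ioi 1 hKint tendsto_id
  have hlimK2 := intervalIntegral_tendsto_integral_Ioi 1 hKint
    (tendsto_id.const_mul_atTop (two_pos : (0 : ℝ) < 2))
  have h0 : Tendsto (fun N : ℝ => ∫ y in N..(2 * N), K y) atTop (𝓝 0) := by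
    refine ((sub_self (∫ y in Ioi (1 : ℝ), K y)) ▸ hlimK2.sub hlimK).congr' ?_
    filter_upwards [eventually_ge_atTop 1] with N hN
    exact intervalIntegral.integral_interval_sub_left (hint le_rfl (by simp; linarith))
      (hint le_rfl hN)
  have hwint : IntegrableOn (fun y : ℝ => (w y : ℂ) * (y : ℂ) ^ (-χ - 1)) (Ioi 1) :=
    integrableOn_Ioi_mul_cpow hw hc (by simp [hχ, hθ])
  have hlimw := intervalIntegral_tendsto_integral_Ioi 1 hwint tendsto_id
  refine (tendsto_nhds_unique hlimw ?_).symm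
  have h1 : Tendsto (fun N : ℝ => (∫ y in (1 : ℝ)..2, K y) - ∫ y in N..(2 * N), K y) atTop
      (𝓝 (∫ y in (1 : ℝ)..2, K y)) := by
    simpa using tendsto_const_nhds.sub h0
  refine h1.congr' ?_
  filter_upwards [eventually_ge_atTop 1] with N hN
  exact (htel N hN).symm

end DyadicSum

/-! ### The interpolated sequence -/

theorem natFloor_eq_of_mem_Ico {n : ℕ} {x : ℝ} (h : x ∈ Ico (n : ℝ) (n + 1)) : ⌊x⌋₊ = n :=
  (Nat.floor_eq_iff (n.cast_nonneg.trans h.1)).2 h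

/-- The defining formula of `extend`, valid up to and including the right end of `[n, n + 1]`. -/
theorem extend_eq {a b : ℝ} (ha : 0 < a) (hb : 0 < b) (h : ℕ → ℝ) {n : ℕ} (hn : 1 ≤ n) {x : ℝ}
    (hx : x ∈ Icc (n : ℝ) (n + 1)) :
    extend a b h x = h n + phi a b (x - n) * (h (n + 1) - h n) := by
  have hn' : (1 : ℝ) ≤ n := by exact_mod_cast hn
  rw [extend, if_neg (not_lt.2 (hn'.trans hx.1))]
  rcases hx.2.eq_or_lt with rfl | hlt
  · have : ⌊(n : ℝ) + 1⌋₊ = n + 1 := by exact_mod_cast Nat.floor_natCast (n + 1)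
    rw [this]
    simp [(phi_spec ha hb).zero, (phi_spec ha hb).one]
  · rw [natFloor_eq_of_mem_Ico ⟨hx.1, hlt⟩]

theorem extend_natCast {a b : ℝ} (ha : 0 < a) (hb : 0 < b) (h : ℕ → ℝ) {n : ℕ} (hn : 1 ≤ n) :
    extend a b h n = h n := by
  rw [extend_eq ha hb h hn (by simp), sub_self, (phi_spec ha hb).zero, zero_mul, add_zero]

theorem extend_eq_zero {a b : ℝ} (h : ℕ → ℝ) {x : ℝ} (hx : x < 1) : extend a b h x = 0 :=
  if_pos hx

theorem exists_nat_mem_Ico {x : ℝ} (hx : 1 ≤ x) : ∃ n : ℕ, 1 ≤ n ∧ x ∈ Ico (n : ℝ) (n + 1) :=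
  ⟨⌊x⌋₊, Nat.le_floor (by simpa using hx), Nat.floor_le (by linarith), Nat.lt_floor_add_one x⟩

theorem continuousOn_extend {a b : ℝ} (ha : 0 < a) (hb : 0 < b) (h : ℕ → ℝ) :
    ContinuousOn (extend a b h) (Ici 1) := by
  have hcov : Ici (1 : ℝ) ⊆ ⋃ n : ℕ, Icc ((n + 1 : ℕ) : ℝ) ((n + 1 : ℕ) + 1) := by
    intro x hx
    obtain ⟨n, hn, hxn⟩ := exists_nat_mem_Ico hx
    refine mem_iUnion.2 ⟨n - 1, ?_⟩
    rw [Nat.sub_add_cancel hn]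
    exact Ico_subset_Icc_self hxn
  have hlf : LocallyFinite fun n : ℕ => Icc ((n + 1 : ℕ) : ℝ) ((n + 1 : ℕ) + 1) := by
    intro x
    refine ⟨Iio (x + 1), Iio_mem_nhds (by linarith), (finite_Iic ⌈x⌉₊).subset ?_⟩
    rintro n ⟨y, hy, hyx⟩
    have h1 := hy.1
    have h2 := Nat.le_ceil x
    rw [mem_Iio] at hyx
    push_cast at h1
    have : (n : ℝ) ≤ (⌈x⌉₊ : ℝ) := by linarith
    exact_mod_cast this
  refine (hlf.continuousOn_iUnion (fun _ => isClosed_Icc) fun n => ?_).mono hcov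
  refine ContinuousOn.congr ?_ fun x hx => extend_eq ha hb h n.succ_pos hx
  refine continuousOn_const.add (ContinuousOn.mul ?_ continuousOn_const)
  refine (phi_spec ha hb).continuousOn.comp (by fun_prop) fun x hx => ?_
  exact ⟨by linarith [hx.1], by linarith [hx.2]⟩

/-- The two-scale equations of `φ` turn the recurrence for the sequence into the functional
equation `F(x) = (α + β) F(x / 2) + G(x)` for the interpolated functions, at every real `x ≥ 2`. -/
theorem extend_two_mul {a b : ℝ} (ha : 0 < a) (hb : 0 < b) {f g : ℕ → ℝ}
    (hf : ∀ n : ℕ, 2 ≤ n → Lam a b f n = g n) {x : ℝ} (hx : 1 ≤ x) :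
    extend a b f (2 * x) = (a + b) * extend a b f x + extend a b g (2 * x) := by
  have hab : a + b ≠ 0 := by positivity
  obtain ⟨n, hn, h1, h2⟩ := exists_nat_mem_Ico hx
  have e0 : f (2 * n) = a * f n + b * f n + g (2 * n) := by
    have := hf (2 * n) (by omega)
    rw [Lam, show 2 * n / 2 = n by omega, show (2 * n + 1) / 2 = n by omega] at this
    linarith
  have e1 : f (2 * n + 1) = a * f n + b * f (n + 1) + g (2 * n + 1) := by
    have := hf (2 * n + 1) (by omega)
    rw [Lam, show (2 * n + 1) / 2 = n by omega, show (2 * n + 1 + 1) / 2 = n + 1 by omega] at this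
    linarith
  have e2 : f (2 * n + 1 + 1) = a * f (n + 1) + b * f (n + 1) + g (2 * n + 1 + 1) := by
    have := hf (2 * n + 1 + 1) (by omega)
    rw [Lam, show (2 * n + 1 + 1) / 2 = n + 1 by omega,
      show (2 * n + 1 + 1 + 1) / 2 = n + 1 by omega] at this
    linarith
  rw [extend_eq ha hb f hn ⟨h1, h2.le⟩]
  rcases le_total (x - n) (1 / 2) with h | h
  · have hm : 2 * x ∈ Icc ((2 * n : ℕ) : ℝ) ((2 * n : ℕ) + 1) := by
      constructor <;> push_cast <;> linarith
    rw [extend_eq ha hb f (by omega) hm, extend_eq ha hb g (by omega) hm, e0, e1,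
      (phi_spec ha hb).left _ ⟨by linarith, h⟩]
    have : 2 * x - ((2 * n : ℕ) : ℝ) = 2 * (x - n) := by push_cast; ring
    rw [this]
    field_simp
    ring
  · have hm : 2 * x ∈ Icc ((2 * n + 1 : ℕ) : ℝ) ((2 * n + 1 : ℕ) + 1) := by
      constructor <;> push_cast <;> linarith
    rw [extend_eq ha hb f (by omega) hm, extend_eq ha hb g (by omega) hm, e1, e2,
      (phi_spec ha hb).right _ ⟨h, by linarith⟩]
    have : 2 * x - ((2 * n + 1 : ℕ) : ℝ) = 2 * (x - n) - 1 := by push_cast; ring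
    rw [this]
    field_simp
    ring

theorem extend_eq_of_mem_Icc_one_two {a b : ℝ} (ha : 0 < a) (hb : 0 < b) {f g : ℕ → ℝ}
    (hf : ∀ n : ℕ, 2 ≤ n → Lam a b f n = g n) (hg1 : g 1 = 0) {x : ℝ} (hx : x ∈ Icc (1 : ℝ) 2) :
    extend a b f x = f 1 * (1 + (a + b - 1) * phi a b (x - 1)) + extend a b g x := by
  have hm : x ∈ Icc ((1 : ℕ) : ℝ) ((1 : ℕ) + 1) := by
    constructor <;> push_cast <;> linarith [hx.1, hx.2]
  have e := hf 2 le_rfl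
  rw [Lam, show 2 / 2 = 1 from rfl] at e
  rw [extend_eq ha hb f le_rfl hm, extend_eq ha hb g le_rfl hm, hg1, Nat.cast_one,
    show 1 + 1 = 2 from rfl, ← e]
  ring

/-! ### Comparison of the interpolated sequence with a power -/

theorem continuousOn_rpow_const_Ici_one (r : ℝ) : ContinuousOn (fun x : ℝ => x ^ r) (Ici 1) :=
  fun x hx => (Real.continuousAt_rpow_const _ _
    (Or.inl (by have := mem_Ici.1 hx; linarith))).continuousWithinAt

theorem rpow_le_of_le_two_mul {y z : ℝ} (hy : 0 < y) (hz : 0 < z) (h1 : y ≤ 2 * z)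
    (h2 : z ≤ 2 * y) (r : ℝ) : y ^ r ≤ 2 ^ |r| * z ^ r := by
  rcases le_total 0 r with hr | hr
  · rw [abs_of_nonneg hr, ← Real.mul_rpow two_pos.le hz.le]
    exact Real.rpow_le_rpow hy.le h1 hr
  · have h := Real.rpow_le_rpow_of_nonpos (by positivity) (by linarith : z / 2 ≤ y) hr
    rw [abs_of_nonpos hr, Real.rpow_neg two_pos.le, inv_mul_eq_div,
      ← Real.div_rpow hz.le two_pos.le]
    exact h

theorem abs_rpow_sub_rpow_le (r : ℝ) {n x y : ℝ} (hn : 1 ≤ n) (hx : x ∈ Icc n (n + 1))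
    (hy : y ∈ Icc n (n + 1)) : |y ^ r - x ^ r| ≤ |r| * 2 ^ |r - 1| * n ^ (r - 1) := by
  have h := (convex_Icc n (n + 1)).norm_image_sub_le_of_norm_hasDerivWithin_le
    (f := fun z : ℝ => z ^ r) (f' := fun z => r * z ^ (r - 1))
    (C := |r| * 2 ^ |r - 1| * n ^ (r - 1)) (fun z hz => ?_) (fun z hz => ?_) hx hy
  · have hxy : |y - x| ≤ 1 := by
      rw [abs_le]; constructor <;> linarith [hx.1, hx.2, hy.1, hy.2]
    refine h.trans (mul_le_of_le_one_right ?_ hxy)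
    have : 0 ≤ n ^ (r - 1) := Real.rpow_nonneg (by linarith) _
    positivity
  · exact (Real.hasDerivAt_rpow_const (Or.inl (by linarith [hz.1]))).hasDerivWithinAt
  · have hz0 : 0 < z := by linarith [hz.1]
    rw [norm_mul, Real.norm_eq_abs, Real.norm_of_nonneg (Real.rpow_nonneg hz0.le _), mul_assoc]
    gcongr
    exact rpow_le_of_le_two_mul hz0 (by linarith) (by linarith [hz.2]) (by linarith [hz.1]) _

/-- If `g(n) = n^ρ + O(n^{ρ-ε})`, then the interpolated function differs from `x^ρ` by
`O(x^{ρ - min(ε, 1)})`; the interpolation itself costs a term of order `x^{ρ-1}`. -/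
theorem exists_abs_extend_sub_rpow_le {a b : ℝ} (ha : 0 < a) (hb : 0 < b) {g g₀ : ℕ → ℝ}
    {r ε : ℝ} (hg : ∀ n : ℕ, 2 ≤ n → g n = (n : ℝ) ^ r + g₀ n)
    (hg₀ : g₀ =O[atTop] fun n : ℕ => (n : ℝ) ^ (r - ε)) :
    ∃ C, ∀ x : ℝ, 1 ≤ x → |extend a b g x - x ^ r| ≤ C * x ^ (r - min ε 1) := by
  set θ := min ε 1
  obtain ⟨M, hM⟩ := isCompact_Icc.exists_bound_of_continuousOn (phi_spec ha hb).continuousOn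
  have hM0 : 0 ≤ M := (norm_nonneg _).trans (hM 0 (by simp))
  -- The value `g 1` is unrelated to `g₀ 1`, but one value does not affect the order of growth.
  obtain ⟨C, hC⟩ : ∃ C, ∀ n : ℕ, 1 ≤ n → |g n - (n : ℝ) ^ r| ≤ C * (n : ℝ) ^ (r - ε) := by
    have h : (fun n : ℕ => g n - (n : ℝ) ^ r) =O[atTop] fun n : ℕ => (n : ℝ) ^ (r - ε) := by
      refine hg₀.congr' ?_ .rfl
      filter_upwards [eventually_ge_atTop 2] with n hn
      rw [hg n hn, add_sub_cancel_left]
    obtain ⟨C, -, hC⟩ := bound_of_isBigO_nat_atTop h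
    refine ⟨C, fun n hn => ?_⟩
    have hn0 : (0 : ℝ) < n := by exact_mod_cast hn
    have := hC (x := n) (Real.rpow_pos_of_pos hn0 _).ne'
    rwa [Real.norm_eq_abs, Real.norm_of_nonneg (by positivity)] at this
  have hC0 : 0 ≤ C := by simpa using (abs_nonneg _).trans (hC 1 le_rfl)
  set D : ℝ := 2 ^ |r - θ| with hD
  have hD0 : 0 ≤ D := by positivity
  set E : ℝ := |r| * 2 ^ |r - 1| with hE
  have hE0 : 0 ≤ E := by positivity
  have hθε : r - ε ≤ r - θ := sub_le_sub_left (min_le_left _ _) _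
  have hθ1 : r - 1 ≤ r - θ := sub_le_sub_left (min_le_right _ _) _
  refine ⟨C * D + M * (C * D + C * D + E * D) + E * D, fun x hx => ?_⟩
  obtain ⟨n, hn, h1, h2⟩ := exists_nat_mem_Ico hx
  have hn1 : (1 : ℝ) ≤ n := by exact_mod_cast hn
  have hx0 : 0 < x := by linarith
  have hcmp : ∀ y s : ℝ, y ∈ Icc (n : ℝ) (n + 1) → s ≤ r - θ → y ^ s ≤ D * x ^ (r - θ) := by
    intro y s hy hs
    have hy1 : 1 ≤ y := hn1.trans hy.1
    exact (Real.rpow_le_rpow_of_exponent_le hy1 hs).trans (rpow_le_of_le_two_mul (by linarith) hx0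
      (by linarith [hy.2]) (by linarith [hy.1]) _)
  have b0 : |g n - (n : ℝ) ^ r| ≤ C * (D * x ^ (r - θ)) :=
    (hC n hn).trans (mul_le_mul_of_nonneg_left (hcmp n _ (by simp) hθε) hC0)
  have b1 : |g (n + 1) - ((n : ℝ) + 1) ^ r| ≤ C * (D * x ^ (r - θ)) := by
    have h := hC (n + 1) (by omega)
    push_cast at h
    exact h.trans (mul_le_mul_of_nonneg_left (hcmp _ _ (by simp) hθε) hC0)
  have bE : E * (n : ℝ) ^ (r - 1) ≤ E * (D * x ^ (r - θ)) :=
    mul_le_mul_of_nonneg_left (hcmp n _ (by simp) hθ1) hE0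
  have b2 : |((n : ℝ) + 1) ^ r - (n : ℝ) ^ r| ≤ E * (D * x ^ (r - θ)) :=
    (abs_rpow_sub_rpow_le r hn1 (by simp) (by simp)).trans bE
  have b3 : |(n : ℝ) ^ r - x ^ r| ≤ E * (D * x ^ (r - θ)) :=
    (abs_rpow_sub_rpow_le r hn1 ⟨h1, h2.le⟩ (by simp)).trans bE
  have bφ : |phi a b (x - n)| ≤ M := hM _ ⟨by linarith, by linarith⟩
  have hsplit : extend a b g x - x ^ r = (g n - (n : ℝ) ^ r) + phi a b (x - n) *
      ((g (n + 1) - ((n : ℝ) + 1) ^ r) + -(g n - (n : ℝ) ^ r)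
        + (((n : ℝ) + 1) ^ r - (n : ℝ) ^ r)) + ((n : ℝ) ^ r - x ^ r) := by
    rw [extend_eq ha hb g hn ⟨h1, h2.le⟩]
    ring
  rw [hsplit]
  refine (abs_add_three _ _ _).trans ?_
  rw [abs_mul]
  have hin := abs_add_three (g (n + 1) - ((n : ℝ) + 1) ^ r) (-(g n - (n : ℝ) ^ r))
    (((n : ℝ) + 1) ^ r - (n : ℝ) ^ r)
  rw [abs_neg] at hin
  have := mul_le_mul bφ (hin.trans (add_le_add_three b1 b0 b2)) (abs_nonneg _) hM0
  linarith

/-! ### Mellin transforms of functions supported on `[1, ∞)` -/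

theorem hasMellin_indicator_Ici {v : ℝ → ℝ} {s : ℂ}
    (h : IntegrableOn (fun y : ℝ => (v y : ℂ) * (y : ℂ) ^ (s - 1)) (Ioi 1)) :
    HasMellin (fun x => (((Ici (1 : ℝ)).indicator v x : ℝ) : ℂ)) s
      (∫ y in Ioi (1 : ℝ), (v y : ℂ) * (y : ℂ) ^ (s - 1)) := by
  have e : (fun x : ℝ => (x : ℂ) ^ (s - 1) • (((Ici (1 : ℝ)).indicator v x : ℝ) : ℂ)) =
      (Ici (1 : ℝ)).indicator fun y : ℝ => (v y : ℂ) * (y : ℂ) ^ (s - 1) := by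
    ext x
    by_cases hx : x ∈ Ici (1 : ℝ)
    · simp [indicator_of_mem hx, mul_comm]
    · simp [indicator_of_notMem hx]
  have hsub : Ioi (0 : ℝ) ∩ Ici 1 = Ici 1 :=
    inter_eq_right.2 fun x hx => lt_of_lt_of_le one_pos (mem_Ici.1 hx)
  refine ⟨?_, ?_⟩
  · rw [MellinConvergent, e]
    exact ((integrable_indicator_iff measurableSet_Ici).2
      (integrableOn_Ici_iff_integrableOn_Ioi (by simp) |>.2 h)).integrableOn
  · rw [mellin, e, setIntegral_indicator measurableSet_Ici, hsub, integral_Ici_eq_integral_Ioi]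

theorem differentiableAt_mellin_indicator_Ici {v : ℝ → ℝ} {C r : ℝ} {s : ℂ}
    (hv : ∀ y, 1 ≤ y → |v y| ≤ C * y ^ r) (hc : ContinuousOn v (Ici 1)) (hs : s.re < -r) :
    DifferentiableAt ℂ (mellin fun x => (((Ici (1 : ℝ)).indicator v x : ℝ) : ℂ)) s := by
  refine mellin_differentiableAt_of_isBigO_rpow (a := -r) (b := s.re - 1) ?_ ?_ hs ?_ (by linarith)
  · refine (locallyIntegrableOn_iff isOpen_Ioi.isLocallyClosed).2 fun K _ hK => ?_
    have e : (fun x => (((Ici (1 : ℝ)).indicator v x : ℝ) : ℂ)) =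
        (Ici (1 : ℝ)).indicator fun x => (v x : ℂ) := by
      ext x
      by_cases hx : x ∈ Ici (1 : ℝ)
      · simp [indicator_of_mem hx]
      · simp [indicator_of_notMem hx]
    rw [e, IntegrableOn, integrable_indicator_iff measurableSet_Ici, IntegrableOn,
      Measure.restrict_restrict measurableSet_Ici, inter_comm]
    exact ContinuousOn.integrableOn_compact (hK.inter_right isClosed_Ici)
      (Complex.continuous_ofReal.comp_continuousOn (hc.mono inter_subset_right))
  · rw [neg_neg]
    refine IsBigO.of_bound C ?_
    filter_upwards [eventually_ge_atTop 1] with y hy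
    rw [indicator_of_mem (mem_Ici.2 hy), Complex.norm_real,
      Real.norm_of_nonneg (Real.rpow_nonneg (by linarith) _)]
    exact hv y hy
  · refine IsBigO.of_bound 0 ?_
    filter_upwards [nhdsWithin_le_nhds (Iio_mem_nhds one_pos)] with y hy
    simp [indicator_of_notMem (notMem_Ici.2 (mem_Iio.1 hy))]

/-- The Mellin transform of `u(x) = x^r + v(x)`, `x ≥ 1`, with the pole coming from the power split
off explicitly. -/
theorem hasMellin_indicator_Ici_of_sub_rpow {u : ℝ → ℝ} {C r r' : ℝ} (hr : r' ≤ r) {s : ℂ}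
    (hu : ∀ y, 1 ≤ y → |u y - y ^ r| ≤ C * y ^ r') (hc : ContinuousOn u (Ici 1))
    (hs : s.re < -r) :
    HasMellin (fun x => (((Ici (1 : ℝ)).indicator u x : ℝ) : ℂ)) s
      (mellin (fun x => (((Ici (1 : ℝ)).indicator (fun y => u y - y ^ r) x : ℝ) : ℂ)) s
        - 1 / (s + r)) := by
  have hv := integrableOn_Ioi_mul_cpow (s := s - 1) hu
    (hc.sub (continuousOn_rpow_const_Ici_one r)) (by simp; linarith)
  have hre : (r + (s - 1) : ℂ).re < -1 := by simp; linarith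
  have hpow := integrableOn_Ioi_cpow_of_lt hre one_pos
  have e : EqOn (fun y : ℝ => ((u y - y ^ r : ℝ) : ℂ) * (y : ℂ) ^ (s - 1)
      + (y : ℂ) ^ (r + (s - 1))) (fun y : ℝ => (u y : ℂ) * (y : ℂ) ^ (s - 1)) (Ioi 1) := by
    intro y hy
    have hy0 : 0 < y := one_pos.trans hy
    simp only
    rw [Complex.cpow_add _ _ (by exact_mod_cast hy0.ne'), Complex.ofReal_sub,
      Complex.ofReal_cpow hy0.le]
    ring
  have hsum := (hv.add hpow).congr_fun e measurableSet_Ioi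
  have h := hasMellin_indicator_Ici hsum
  refine ⟨h.1, h.2.trans ?_⟩
  rw [(hasMellin_indicator_Ici hv).2, ← setIntegral_congr_fun measurableSet_Ioi e,
    integral_add hv hpow, integral_Ioi_cpow_of_lt hre one_pos, Complex.ofReal_one,
    Complex.one_cpow, show (r + (s - 1) + 1 : ℂ) = s + r by ring]
  ring

theorem indicator_extend (a b : ℝ) (h : ℕ → ℝ) :
    (Ici (1 : ℝ)).indicator (extend a b h) = extend a b h := by
  refine indicator_eq_self.2 fun x hx => ?_
  by_contra hlt
  exact hx (extend_eq_zero h (not_le.1 hlt))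

/-! ### Fourier coefficients in multiplicative form -/

theorem chi_re (k : ℤ) : (chi k).re = 0 := by
  have : chi k = ((2 * k * Real.pi / Real.log 2 : ℝ) : ℂ) * Complex.I := by simp [chi]
  rw [this, Complex.re_ofReal_mul, Complex.I_re, mul_zero]

theorem ofReal_log_two_ne_zero : (Real.log 2 : ℂ) ≠ 0 :=
  Complex.ofReal_ne_zero.2 (Real.log_pos one_lt_two).ne'

theorem log_two_mul_chi (k : ℤ) : (Real.log 2 : ℂ) * chi k = 2 * k * Real.pi * Complex.I := by
  have := ofReal_log_two_ne_zero
  rw [chi]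
  field_simp

theorem chi_ne_zero {k : ℤ} (hk : k ≠ 0) : chi k ≠ 0 := by
  intro h
  have := log_two_mul_chi k
  rw [h, mul_zero] at this
  simp [hk, Real.pi_ne_zero] at this

theorem two_rpow_cpow_neg_chi (k : ℤ) (t : ℝ) :
    (((2 : ℝ) ^ t : ℝ) : ℂ) ^ (-chi k) = Complex.exp (-2 * k * Real.pi * Complex.I * t) := by
  have h : (((2 : ℝ) ^ t : ℝ) : ℂ) ≠ 0 := Complex.ofReal_ne_zero.2 (by positivity)
  rw [Complex.cpow_def_of_ne_zero h, ← Complex.ofReal_log (by positivity), Real.log_rpow two_pos,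
    Complex.ofReal_mul, mul_assoc, mul_neg, log_two_mul_chi]
  congr 1
  ring

theorem exp_neg_two_mul_int_mul_pi (k : ℤ) : Complex.exp (-2 * k * Real.pi * Complex.I) = 1 := by
  rw [← Complex.exp_int_mul_two_pi_mul_I (-k)]
  congr 1
  push_cast
  ring

theorem two_cpow_chi (k : ℤ) : (2 : ℂ) ^ chi k = 1 := by
  have h := two_rpow_cpow_neg_chi (-k) 1
  rw [Complex.ofReal_one, mul_one, exp_neg_two_mul_int_mul_pi, Real.rpow_one] at h
  rwa [show -chi (-k) = chi k by simp [chi]; ring, Complex.ofReal_ofNat] at h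

/-- The substitution `y = 2^t` in a Fourier integral; the character `e^{-2kπit}` becomes
`y^{-χ_k}`. -/
theorem integral_two_rpow_mul_exp {q : ℝ → ℝ} (hq : ContinuousOn q (Icc 1 2)) (k : ℤ) :
    ∫ t in (0 : ℝ)..1, (q (2 ^ t) : ℂ) * Complex.exp (-2 * k * Real.pi * Complex.I * t) =
      1 / Real.log 2 * ∫ y in (1 : ℝ)..2, (q y : ℂ) * (y : ℂ) ^ (-chi k - 1) := by
  have hl := ofReal_log_two_ne_zero
  have himg : (fun t : ℝ => (2 : ℝ) ^ t) '' uIcc 0 1 ⊆ Icc 1 2 := by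
    rintro _ ⟨t, ht, rfl⟩
    rw [uIcc_of_le zero_le_one] at ht
    exact ⟨Real.one_le_rpow one_le_two ht.1,
      (Real.rpow_le_rpow_of_exponent_le one_le_two ht.2).trans_eq (Real.rpow_one 2)⟩
  have hder : ∀ t : ℝ, HasDerivAt (fun t : ℝ => (2 : ℝ) ^ t) (2 ^ t * Real.log 2) t := fun t => by
    simpa using (Real.hasStrictDerivAt_const_rpow two_pos t).hasDerivAt
  have hcont : Continuous fun t : ℝ => (2 : ℝ) ^ t := Real.continuous_const_rpow two_ne_zero
  have h := intervalIntegral.integral_deriv_smul_comp'' (a := 0) (b := 1)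
    (f := fun t : ℝ => (2 : ℝ) ^ t) (f' := fun t : ℝ => (2 : ℝ) ^ t * Real.log 2)
    (g := fun y : ℝ => (q y : ℂ) * (y : ℂ) ^ (-chi k - 1)) hcont.continuousOn
    (fun t _ => (hder t).hasDerivWithinAt) (hcont.mul continuous_const).continuousOn ?_
  · rw [Real.rpow_zero, Real.rpow_one] at h
    rw [← h, ← intervalIntegral.integral_const_mul]
    refine intervalIntegral.integral_congr fun t _ => ?_
    have h0 : (((2 : ℝ) ^ t : ℝ) : ℂ) ≠ 0 := Complex.ofReal_ne_zero.2 (by positivity)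
    simp only [Function.comp, Complex.real_smul]
    rw [Complex.cpow_sub _ _ h0, Complex.cpow_one, two_rpow_cpow_neg_chi, Complex.ofReal_mul]
    field_simp
  · refine ContinuousOn.mono ?_ himg
    refine (Complex.continuous_ofReal.comp_continuousOn hq).mul fun y hy => ?_
    exact (Complex.continuousAt_ofReal_cpow_const _ _
      (Or.inr (by linarith [hy.1]))).continuousWithinAt

theorem fourierCoef_one_sub_of_ne_zero {k : ℤ} (hk : k ≠ 0) :
    fourierCoef (fun t => 1 - t) k = 1 / Real.log 2 * (1 / chi k) := by
  set c : ℂ := -2 * k * Real.pi * Complex.I with hc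
  have hlc : (Real.log 2 : ℂ) * chi k = -c := by rw [log_two_mul_chi, hc]; ring
  have hc0 : c ≠ 0 := by
    rw [← neg_ne_zero, ← hlc]
    exact mul_ne_zero ofReal_log_two_ne_zero (chi_ne_zero hk)
  have hder : ∀ t ∈ uIcc (0 : ℝ) 1, HasDerivAt
      (fun t : ℝ => (1 - (t : ℂ)) * (Complex.exp (c * t) / c) + Complex.exp (c * t) / c ^ 2)
      (((1 - t : ℝ) : ℂ) * Complex.exp (c * t)) t := by
    intro t _
    have h1 : HasDerivAt (fun t : ℝ => (t : ℂ)) 1 t := Complex.ofRealCLM.hasDerivAt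
    have h2 : HasDerivAt (fun t : ℝ => Complex.exp (c * t)) (Complex.exp (c * t) * (c * 1)) t :=
      (h1.const_mul c).cexp
    refine (((h1.const_sub 1).mul (h2.div_const c)).add (h2.div_const (c ^ 2))).congr_deriv ?_
    push_cast
    field_simp
    ring
  rw [fourierCoef, intervalIntegral.integral_eq_sub_of_hasDerivAt hder
    (Continuous.intervalIntegrable (by fun_prop) _ _), div_mul_div_comm, hlc, Complex.ofReal_one,
    mul_one, Complex.ofReal_zero, mul_zero, Complex.exp_zero, hc, exp_neg_two_mul_int_mul_pi, ← hc]
  field_simp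
  ring

theorem fourierCoef_one_sub_zero : fourierCoef (fun t => 1 - t) 0 = 1 / 2 := by
  have h : ∫ t in (0 : ℝ)..1, (1 - t) = 1 / 2 := by
    rw [intervalIntegral.integral_sub (by simp) (by simp)]
    norm_num
  have := congrArg Complex.ofReal h
  rw [← intervalIntegral.integral_ofReal] at this
  simpa [fourierCoef] using this

theorem initialIntegral_eq (a b : ℝ) (k : ℤ) :
    initialIntegral a b k = ∫ y in (1 : ℝ)..2,
      ((y ^ (-rho a b) * (1 + (a + b - 1) * phi a b (y - 1)) : ℝ) : ℂ)
        * (y : ℂ) ^ (-chi k - 1) := by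
  have h := intervalIntegral.integral_comp_add_right (a := 0) (b := 1) (fun y : ℝ =>
    ((y ^ (-rho a b) * (1 + (a + b - 1) * phi a b (y - 1)) : ℝ) : ℂ)
      * (y : ℂ) ^ (-chi k - 1)) 1
  rw [zero_add, one_add_one_eq_two] at h
  rw [← h, initialIntegral]
  refine intervalIntegral.integral_congr fun u hu => ?_
  rw [uIcc_of_le zero_le_one] at hu
  have hu0 : 0 < 1 + u := by linarith [hu.1]
  have hu1 : ((1 + u : ℝ) : ℂ) ≠ 0 := Complex.ofReal_ne_zero.2 hu0.ne'
  rw [add_sub_cancel_right, add_comm u 1, div_eq_mul_inv, ← Complex.cpow_neg,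
    show -((rho a b : ℂ) + chi k + 1) = ((-rho a b : ℝ) : ℂ) + (-chi k - 1) by push_cast; ring,
    Complex.cpow_add _ _ hu1, ← Complex.ofReal_cpow hu0.le, Complex.ofReal_mul]
  ring

/-! ### The periodic function -/

/-- The relative error `x^{-ρ} (g(x) - x^ρ)` of the interpolated sequence `g`. -/
noncomputable def relError (a b : ℝ) (g : ℕ → ℝ) (x : ℝ) : ℝ :=
  x ^ (-rho a b) * (extend a b g x - x ^ rho a b)

/-- The function `x^{-ρ} f(x) - log₂ x + ∑_{j ≥ 1} w(2^j x)`, with `w` the relative error of `g`.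
On `[1, ∞)` it is invariant under `x ↦ 2x`. -/
noncomputable def profile (a b : ℝ) (f g : ℕ → ℝ) (x : ℝ) : ℝ :=
  x ^ (-rho a b) * extend a b f x - Real.logb 2 x + dyadicSum (relError a b g) (2 * x)

section Profile

variable {a b : ℝ} {f g : ℕ → ℝ} {C θ : ℝ}

theorem two_rpow_rho (ha : 0 < a) (hb : 0 < b) : (2 : ℝ) ^ rho a b = a + b :=
  Real.rpow_logb two_pos (by norm_num) (by positivity)

theorem rpow_neg_mul_extend {x : ℝ} (hx : 0 < x) :
    x ^ (-rho a b) * extend a b g x = 1 + relError a b g x := by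
  rw [relError, mul_sub, ← Real.rpow_add hx, neg_add_cancel, Real.rpow_zero]
  ring

theorem abs_relError_le
    (hB : ∀ x, 1 ≤ x → |extend a b g x - x ^ rho a b| ≤ C * x ^ (rho a b - θ)) {x : ℝ}
    (hx : 1 ≤ x) : |relError a b g x| ≤ C * x ^ (-θ) := by
  have hx0 : 0 < x := by linarith
  rw [relError, abs_mul, abs_of_pos (Real.rpow_pos_of_pos hx0 _)]
  refine (mul_le_mul_of_nonneg_left (hB x hx) (Real.rpow_nonneg hx0.le _)).trans_eq ?_
  rw [mul_left_comm, ← Real.rpow_add hx0]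
  ring_nf

theorem continuousOn_relError (ha : 0 < a) (hb : 0 < b) :
    ContinuousOn (relError a b g) (Ici 1) :=
  (continuousOn_rpow_const_Ici_one _).mul
    ((continuousOn_extend ha hb g).sub (continuousOn_rpow_const_Ici_one _))

theorem continuousOn_logb_two : ContinuousOn (Real.logb 2) (Ici 1) := fun x hx =>
  (Real.continuousAt_logb (by have := mem_Ici.1 hx; linarith)).continuousWithinAt

theorem continuousOn_profile (ha : 0 < a) (hb : 0 < b) (hθ : 0 < θ)
    (hB : ∀ x, 1 ≤ x → |extend a b g x - x ^ rho a b| ≤ C * x ^ (rho a b - θ)) :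
    ContinuousOn (profile a b f g) (Ici 1) := by
  refine (((continuousOn_rpow_const_Ici_one _).mul (continuousOn_extend ha hb f)).sub
    continuousOn_logb_two).add ?_
  refine (continuousOn_dyadicSum hθ (fun x => abs_relError_le hB)
    (continuousOn_relError ha hb)).comp (by fun_prop) fun x hx => ?_
  have := mem_Ici.1 hx
  exact mem_Ici.2 (by linarith)

theorem profile_two_mul (ha : 0 < a) (hb : 0 < b) (hθ : 0 < θ)
    (hB : ∀ x, 1 ≤ x → |extend a b g x - x ^ rho a b| ≤ C * x ^ (rho a b - θ))
    (hf : ∀ n : ℕ, 2 ≤ n → Lam a b f n = g n) {x : ℝ} (hx : 1 ≤ x) :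
    profile a b f g (2 * x) = profile a b f g x := by
  have hx0 : 0 < x := by linarith
  have hS := dyadicSum_eq_add hθ (fun x => abs_relError_le hB) (y := 2 * x) (by linarith)
  have hlog : Real.logb 2 (2 * x) = 1 + Real.logb 2 x := by
    rw [Real.logb_mul two_ne_zero hx0.ne', Real.logb_self_eq_one one_lt_two]
  have hpow : (2 * x) ^ (-rho a b) * (a + b) = x ^ (-rho a b) := by
    rw [Real.mul_rpow two_pos.le hx0.le, Real.rpow_neg two_pos.le, two_rpow_rho ha hb]
    field_simp
  have hF : (2 * x) ^ (-rho a b) * extend a b f (2 * x) =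
      x ^ (-rho a b) * extend a b f x + (1 + relError a b g (2 * x)) := by
    rw [extend_two_mul ha hb hf hx, mul_add, ← mul_assoc, hpow,
      rpow_neg_mul_extend (by linarith : 0 < 2 * x)]
  rw [profile, profile, hF, hlog, hS]
  ring

theorem profile_two_pow_mul (ha : 0 < a) (hb : 0 < b) (hθ : 0 < θ)
    (hB : ∀ x, 1 ≤ x → |extend a b g x - x ^ rho a b| ≤ C * x ^ (rho a b - θ))
    (hf : ∀ n : ℕ, 2 ≤ n → Lam a b f n = g n) {x : ℝ} (hx : 1 ≤ x) (m : ℕ) :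
    profile a b f g (2 ^ m * x) = profile a b f g x := by
  induction m with
  | zero => simp
  | succ m ih =>
    rw [pow_succ', mul_assoc, profile_two_mul ha hb hθ hB hf (one_le_two_pow_mul hx m), ih]

theorem profile_two_rpow_fract (ha : 0 < a) (hb : 0 < b) (hθ : 0 < θ)
    (hB : ∀ x, 1 ≤ x → |extend a b g x - x ^ rho a b| ≤ C * x ^ (rho a b - θ))
    (hf : ∀ n : ℕ, 2 ≤ n → Lam a b f n = g n) {x : ℝ} (hx : 1 ≤ x) :
    profile a b f g (2 ^ Int.fract (Real.logb 2 x)) = profile a b f g x := by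
  obtain ⟨m, hm⟩ := Int.eq_ofNat_of_zero_le (Int.floor_nonneg.2 (Real.logb_nonneg one_lt_two hx))
  have h1 : 1 ≤ (2 : ℝ) ^ Int.fract (Real.logb 2 x) :=
    Real.one_le_rpow one_le_two (Int.fract_nonneg _)
  rw [← profile_two_pow_mul ha hb hθ hB hf h1 m, ← Real.rpow_natCast, ← Real.rpow_add two_pos]
  have : (m : ℝ) + Int.fract (Real.logb 2 x) = Real.logb 2 x := by
    have h := Int.floor_add_fract (Real.logb 2 x)
    rwa [hm, Int.cast_natCast] at h
  rw [this, Real.rpow_logb two_pos (by norm_num) (by linarith)]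

theorem continuous_profile_two_rpow_fract (ha : 0 < a) (hb : 0 < b) (hθ : 0 < θ)
    (hB : ∀ x, 1 ≤ x → |extend a b g x - x ^ rho a b| ≤ C * x ^ (rho a b - θ))
    (hf : ∀ n : ℕ, 2 ≤ n → Lam a b f n = g n) :
    Continuous fun t : ℝ => profile a b f g (2 ^ Int.fract t) := by
  refine ContinuousOn.comp_fract'' (f := fun t : ℝ => profile a b f g (2 ^ t)) ?_ ?_
  · refine (continuousOn_profile ha hb hθ hB).comp
      (Real.continuous_const_rpow two_ne_zero).continuousOn fun t ht => ?_
    exact Real.one_le_rpow one_le_two ht.1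
  · have := profile_two_mul ha hb hθ hB hf (x := 1) le_rfl
    simp only [Real.rpow_zero, Real.rpow_one]
    rw [← this, mul_one]

/-- On the fundamental interval `[1, 2]` the dyadic sum absorbs the term of `g`, and only the
initial value `f(1)` is left of `f`. -/
theorem profile_eq_of_mem_Icc_one_two (ha : 0 < a) (hb : 0 < b) (hθ : 0 < θ)
    (hB : ∀ x, 1 ≤ x → |extend a b g x - x ^ rho a b| ≤ C * x ^ (rho a b - θ))
    (hf : ∀ n : ℕ, 2 ≤ n → Lam a b f n = g n) (hg1 : g 1 = 0) {x : ℝ} (hx : x ∈ Icc (1 : ℝ) 2) :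
    profile a b f g x = f 1 * (x ^ (-rho a b) * (1 + (a + b - 1) * phi a b (x - 1)))
      + dyadicSum (relError a b g) x + (1 - Real.logb 2 x) := by
  rw [profile, extend_eq_of_mem_Icc_one_two ha hb hf hg1 hx, mul_add,
    rpow_neg_mul_extend (by linarith [hx.1]),
    dyadicSum_eq_add hθ (fun x => abs_relError_le hB) hx.1]
  ring

theorem fourierCoef_profile (ha : 0 < a) (hb : 0 < b) (hθ : 0 < θ)
    (hB : ∀ x, 1 ≤ x → |extend a b g x - x ^ rho a b| ≤ C * x ^ (rho a b - θ))
    (hf : ∀ n : ℕ, 2 ≤ n → Lam a b f n = g n) (hg1 : g 1 = 0) (k : ℤ) :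
    fourierCoef (fun t => profile a b f g (2 ^ Int.fract t)) k =
      (f 1 : ℂ) / Real.log 2 * initialIntegral a b k
        + 1 / Real.log 2 * mellin (fun x => (((Ici (1 : ℝ)).indicator
            (fun y => extend a b g y - y ^ rho a b) x : ℝ) : ℂ)) (-(rho a b : ℂ) - chi k)
        + fourierCoef (fun t => 1 - t) k := by
  set A : ℝ → ℝ := fun x => x ^ (-rho a b) * (1 + (a + b - 1) * phi a b (x - 1)) with hA
  set S : ℝ → ℝ := dyadicSum (relError a b g) with hS
  have hAc : ContinuousOn A (Icc 1 2) := by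
    refine ((continuousOn_rpow_const_Ici_one _).mono Icc_subset_Ici_self).mul
      (continuousOn_const.add (continuousOn_const.mul ?_))
    exact (phi_spec ha hb).continuousOn.comp (by fun_prop) fun x hx =>
      ⟨by linarith [hx.1], by linarith [hx.2]⟩
  have hw : ∀ x, 1 ≤ x → |relError a b g x| ≤ C * x ^ (-θ) := fun x => abs_relError_le hB
  have hSc : ContinuousOn S (Icc 1 2) :=
    (continuousOn_dyadicSum hθ hw (continuousOn_relError ha hb)).mono Icc_subset_Ici_self
  have hmem : ∀ t ∈ Icc (0 : ℝ) 1, (2 : ℝ) ^ t ∈ Icc (1 : ℝ) 2 := fun t ht =>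
    ⟨Real.one_le_rpow one_le_two ht.1,
      (Real.rpow_le_rpow_of_exponent_le one_le_two ht.2).trans_eq (Real.rpow_one 2)⟩
  have hint : ∀ q : ℝ → ℝ, ContinuousOn q (Icc 1 2) → IntervalIntegrable (fun t : ℝ =>
      (q (2 ^ t) : ℂ) * Complex.exp (-2 * k * Real.pi * Complex.I * t)) volume 0 1 := by
    intro q hq
    refine ContinuousOn.intervalIntegrable ?_
    rw [uIcc_of_le zero_le_one]
    refine (Complex.continuous_ofReal.comp_continuousOn (hq.comp
      (Real.continuous_const_rpow two_ne_zero).continuousOn hmem)).mul ?_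
    exact Continuous.continuousOn (by fun_prop)
  have hsplit : fourierCoef (fun t => profile a b f g (2 ^ Int.fract t)) k =
      ∫ t in (0 : ℝ)..1, ((f 1 : ℂ) *
          ((A (2 ^ t) : ℂ) * Complex.exp (-2 * k * Real.pi * Complex.I * t))
        + (S (2 ^ t) : ℂ) * Complex.exp (-2 * k * Real.pi * Complex.I * t)
        + ((1 - t : ℝ) : ℂ) * Complex.exp (-2 * k * Real.pi * Complex.I * t)) := by
    refine intervalIntegral.integral_congr fun t ht => ?_
    rw [uIcc_of_le zero_le_one] at ht
    have hfr : profile a b f g (2 ^ Int.fract t) = profile a b f g (2 ^ t) := by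
      rw [← profile_two_rpow_fract ha hb hθ hB hf (hmem t ht).1,
        Real.logb_rpow two_pos (by norm_num)]
    simp only
    rw [hfr, profile_eq_of_mem_Icc_one_two ha hb hθ hB hf hg1 (hmem t ht),
      Real.logb_rpow two_pos (by norm_num), hA]
    push_cast
    ring
  have hmel : mellin (fun x => (((Ici (1 : ℝ)).indicator
      (fun y => extend a b g y - y ^ rho a b) x : ℝ) : ℂ)) (-(rho a b : ℂ) - chi k) =
      ∫ y in Ioi (1 : ℝ), (relError a b g y : ℂ) * (y : ℂ) ^ (-chi k - 1) := by
    rw [(hasMellin_indicator_Ici (integrableOn_Ioi_mul_cpow hB ((continuousOn_extend ha hb g).sub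
      (continuousOn_rpow_const_Ici_one _)) (by
        rw [Complex.sub_re, Complex.sub_re, Complex.neg_re, chi_re, Complex.ofReal_re,
          Complex.one_re]
        linarith))).2]
    refine setIntegral_congr_fun measurableSet_Ioi fun y hy => ?_
    have hy0 : 0 < y := one_pos.trans hy
    rw [relError, show -(rho a b : ℂ) - chi k - 1 = ((-rho a b : ℝ) : ℂ) + (-chi k - 1) by
      push_cast; ring, Complex.cpow_add _ _ (Complex.ofReal_ne_zero.2 hy0.ne'),
      ← Complex.ofReal_cpow hy0.le, Complex.ofReal_mul]
    ring
  rw [hsplit, intervalIntegral.integral_add (((hint A hAc).const_mul _).add (hint S hSc))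
      (Continuous.intervalIntegrable (by fun_prop) _ _),
    intervalIntegral.integral_add ((hint A hAc).const_mul _) (hint S hSc),
    intervalIntegral.integral_const_mul, integral_two_rpow_mul_exp hAc,
    integral_two_rpow_mul_exp hSc, ← initialIntegral_eq, hmel, hS,
    integral_dyadicSum_mul_cpow hθ hw (continuousOn_relError ha hb) (chi_re k) (two_cpow_chi k),
    fourierCoef]
  ring

theorem isLittleO_rpow_mul_dyadicSum (hθ : 0 < θ)
    (hB : ∀ x, 1 ≤ x → |extend a b g x - x ^ rho a b| ≤ C * x ^ (rho a b - θ)) :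
    (fun n : ℕ => (n : ℝ) ^ rho a b * dyadicSum (relError a b g) (2 * n)) =o[atTop]
      fun n : ℕ => (n : ℝ) ^ rho a b := by
  have hlim : Tendsto (fun n : ℕ => dyadicSum (relError a b g) (2 * n)) atTop (𝓝 0) := by
    have h1 : Tendsto (fun n : ℕ => (2 * n : ℝ)) atTop atTop :=
      tendsto_natCast_atTop_atTop.const_mul_atTop two_pos
    have h2 := ((tendsto_rpow_neg_atTop hθ).comp h1).const_mul
      (C * ∑' j : ℕ, ((2 : ℝ) ^ (-θ)) ^ j)
    rw [mul_zero] at h2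
    refine squeeze_zero_norm' ?_ h2
    filter_upwards [eventually_ge_atTop 1] with n hn
    have hn1 : (1 : ℝ) ≤ n := by exact_mod_cast hn
    exact abs_dyadicSum_le hθ (fun x => abs_relError_le hB) (by linarith)
  simpa using (isBigO_refl (fun n : ℕ => (n : ℝ) ^ rho a b) atTop).mul_isLittleO
    ((isLittleO_one_iff ℝ).2 hlim)

theorem dyadicSum_relError_eq_zero (ha : 0 < a) (hb : 0 < b)
    (hg : ∀ n : ℕ, 2 ≤ n → Even n → g n = (n : ℝ) ^ rho a b) {n : ℕ} (hn : 1 ≤ n) :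
    dyadicSum (relError a b g) (2 * n) = 0 := by
  refine (tsum_congr fun j => ?_).trans tsum_zero
  have hpos : 1 ≤ 2 ^ j * n := Nat.mul_pos (by positivity) hn
  have e : (2 : ℝ) ^ j * (2 * n) = ((2 * (2 ^ j * n) : ℕ) : ℝ) := by push_cast; ring
  rw [e, relError, extend_natCast ha hb g (by omega), hg _ (by omega) (even_two_mul _), sub_self,
    mul_zero]

theorem eq_rpow_mul_profile {n : ℕ} (ha : 0 < a) (hb : 0 < b) (hn : 1 ≤ n) :
    f n = (n : ℝ) ^ rho a b * Real.logb 2 n + (n : ℝ) ^ rho a b * profile a b f g n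
      - (n : ℝ) ^ rho a b * dyadicSum (relError a b g) (2 * n) := by
  have hn0 : (0 : ℝ) < n := by exact_mod_cast hn
  have h : (n : ℝ) ^ rho a b * (n : ℝ) ^ (-rho a b) = 1 := by
    rw [← Real.rpow_add hn0, add_neg_cancel, Real.rpow_zero]
  rw [profile, extend_natCast ha hb f hn]
  linear_combination (-f n) * h

end Profile

/-! ### The continued Mellin transform -/

section Continuation

variable {a b : ℝ} {g : ℕ → ℝ} {C θ : ℝ}

/-- The meromorphic continuation of the Mellin transform of `g`: the transform of
`g(x) - x^ρ` on `[1, ∞)`, plus the transform `-1 / (s + ρ)` of `x^ρ` on `[1, ∞)`. -/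
noncomputable def mellinCont (a b : ℝ) (g : ℕ → ℝ) (s : ℂ) : ℂ :=
  mellin (fun x => (((Ici (1 : ℝ)).indicator
    (fun y => extend a b g y - y ^ rho a b) x : ℝ) : ℂ)) s - 1 / (s + rho a b)

theorem analyticAt_mellin_remainder (ha : 0 < a) (hb : 0 < b)
    (hB : ∀ x, 1 ≤ x → |extend a b g x - x ^ rho a b| ≤ C * x ^ (rho a b - θ)) {s : ℂ}
    (hs : s.re < -rho a b + θ) :
    AnalyticAt ℂ (mellin (fun x => (((Ici (1 : ℝ)).indicator
      (fun y => extend a b g y - y ^ rho a b) x : ℝ) : ℂ))) s := by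
  refine Complex.analyticAt_iff_eventually_differentiableAt.2 ?_
  filter_upwards [(isOpen_lt Complex.continuous_re continuous_const).mem_nhds hs] with z hz
  have hz' : z.re < -rho a b + θ := hz
  exact differentiableAt_mellin_indicator_Ici hB ((continuousOn_extend ha hb g).sub
    (continuousOn_rpow_const_Ici_one _)) (by linarith)

theorem analyticAt_mellinCont (ha : 0 < a) (hb : 0 < b)
    (hB : ∀ x, 1 ≤ x → |extend a b g x - x ^ rho a b| ≤ C * x ^ (rho a b - θ)) {s : ℂ}
    (hs : s.re < -rho a b + θ) (hne : s ≠ -(rho a b : ℂ)) :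
    AnalyticAt ℂ (mellinCont a b g) s :=
  (analyticAt_mellin_remainder ha hb hB hs).sub (analyticAt_const.div
    (analyticAt_id.add analyticAt_const) fun h => hne (eq_neg_of_add_eq_zero_left h))

theorem meromorphicOn_mellinCont (ha : 0 < a) (hb : 0 < b)
    (hB : ∀ x, 1 ≤ x → |extend a b g x - x ^ rho a b| ≤ C * x ^ (rho a b - θ)) :
    MeromorphicOn (mellinCont a b g) {s : ℂ | s.re < -rho a b + θ} := fun _ hs =>
  (analyticAt_mellin_remainder ha hb hB hs).meromorphicAt.sub
    (analyticAt_const.meromorphicAt.div (analyticAt_id.add analyticAt_const).meromorphicAt)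

theorem meromorphicOrderAt_mellinCont (ha : 0 < a) (hb : 0 < b) (hθ : 0 < θ)
    (hB : ∀ x, 1 ≤ x → |extend a b g x - x ^ rho a b| ≤ C * x ^ (rho a b - θ)) :
    meromorphicOrderAt (mellinCont a b g) (-(rho a b : ℂ)) = ((-1 : ℤ) : WithTop ℤ) := by
  have hs : (-(rho a b : ℂ)).re < -rho a b + θ := by simp [hθ]
  refine (meromorphicOrderAt_eq_int_iff (meromorphicOn_mellinCont ha hb hB _ hs)).2
    ⟨fun z => (z + rho a b) * mellin (fun x => (((Ici (1 : ℝ)).indicator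
      (fun y => extend a b g y - y ^ rho a b) x : ℝ) : ℂ)) z - 1,
      ((analyticAt_id.add analyticAt_const).mul
        (analyticAt_mellin_remainder ha hb hB hs)).sub analyticAt_const, by simp, ?_⟩
  filter_upwards [self_mem_nhdsWithin] with z hz
  have hz0 : z + rho a b ≠ 0 := fun h => hz (eq_neg_of_add_eq_zero_left h)
  rw [mellinCont, sub_neg_eq_add, zpow_neg_one, smul_eq_mul]
  field_simp

theorem hasFiniteValue_mellinCont (ha : 0 < a) (hb : 0 < b) (hθ : 0 < θ)
    (hB : ∀ x, 1 ≤ x → |extend a b g x - x ^ rho a b| ≤ C * x ^ (rho a b - θ)) :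
    HasFiniteValue (mellinCont a b g) (-(rho a b : ℂ)) (mellin (fun x => (((Ici (1 : ℝ)).indicator
      (fun y => extend a b g y - y ^ rho a b) x : ℝ) : ℂ)) (-(rho a b : ℂ))) := by
  refine ⟨-Polynomial.X, _, by simp, analyticAt_mellin_remainder ha hb hB (by simp [hθ]), rfl,
    .of_forall fun z => ?_⟩
  rw [mellinCont, Polynomial.eval_neg, Polynomial.eval_X, sub_neg_eq_add, one_div]
  ring

theorem hasMellin_mellinCont (ha : 0 < a) (hb : 0 < b) (hθ : 0 < θ)
    (hB : ∀ x, 1 ≤ x → |extend a b g x - x ^ rho a b| ≤ C * x ^ (rho a b - θ)) {s : ℂ}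
    (hs : s.re < -rho a b) :
    HasMellin (fun x => (extend a b g x : ℂ)) s (mellinCont a b g s) := by
  have h := hasMellin_indicator_Ici_of_sub_rpow (by linarith) hB (continuousOn_extend ha hb g) hs
  rwa [indicator_extend] at h

theorem mellin_extend (s : ℂ) : mellin (fun x => (extend a b g x : ℂ)) s =
    ∫ y in Ioi (1 : ℝ), (extend a b g y : ℂ) * (y : ℂ) ^ (s - 1) := by
  have h0 : ∀ y ∈ Ioi (0 : ℝ) \ Ici 1, (y : ℂ) ^ (s - 1) • (extend a b g y : ℂ) = 0 := by
    intro y hy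
    rw [extend_eq_zero g (not_le.1 hy.2), Complex.ofReal_zero, smul_zero]
  have hsub : Ici (1 : ℝ) ⊆ Ioi 0 := fun y hy => lt_of_lt_of_le one_pos (mem_Ici.1 hy)
  rw [mellin, setIntegral_eq_of_subset_of_forall_sdiff_eq_zero measurableSet_Ioi hsub h0,
    integral_Ici_eq_integral_Ioi]
  simp only [smul_eq_mul, mul_comm]

theorem mellinCont_eq_integral (ha : 0 < a) (hb : 0 < b) (hθ : 0 < θ)
    (hB : ∀ x, 1 ≤ x → |extend a b g x - x ^ rho a b| ≤ C * x ^ (rho a b - θ)) {s z : ℂ}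
    (hs : s.re < -rho a b) (hz : z = 1 - s) :
    mellinCont a b g s = ∫ u in Ioi (1 : ℝ), (extend a b g u : ℂ) / (u : ℂ) ^ z := by
  rw [← (hasMellin_mellinCont ha hb hθ hB hs).2, mellin_extend]
  simp only [hz, div_eq_mul_inv, ← Complex.cpow_neg, neg_sub]

end Continuation

end DivConq

open DivConq in
theorem theoremA2 (a b : ℝ) (ha : 0 < a) (hb : 0 < b)
    (f g g₀ : ℕ → ℝ) (ε : ℝ) (hε : 0 < ε)
    (hf : ∀ n : ℕ, 2 ≤ n → DivConq.Lam a b f n = g n)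
    (hg1 : g 1 = 0)
    (hg : ∀ n : ℕ, 2 ≤ n → g n = (n : ℝ) ^ DivConq.rho a b + g₀ n)
    (hg₀ : g₀ =O[atTop] fun n : ℕ => (n : ℝ) ^ (DivConq.rho a b - ε)) :
    ∃ (P : ℝ → ℝ) (Q : ℕ → ℝ) (G : ℂ → ℂ),
      -- the exact formula for `f`
      Continuous P ∧ Function.Periodic P 1 ∧
      Q =o[atTop] (fun n : ℕ => (n : ℝ) ^ DivConq.rho a b) ∧
      (∀ n : ℕ, 1 ≤ n →
        f n = (n : ℝ) ^ DivConq.rho a b * Real.logb 2 n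
          + (n : ℝ) ^ DivConq.rho a b * P (Real.logb 2 n) - Q n) ∧
      -- `G` is the continued Mellin transform of `g`, with a sole, simple pole
      DivConq.IsMellinContinuation (DivConq.extend a b g)
        (-DivConq.rho a b) (-DivConq.rho a b + min ε 1) G ∧
      (∀ s : ℂ, s.re < -DivConq.rho a b + min ε 1 → s ≠ -(DivConq.rho a b : ℂ) →
        AnalyticAt ℂ G s) ∧
      meromorphicOrderAt G (-(DivConq.rho a b : ℂ)) = ((-1 : ℤ) : WithTop ℤ) ∧
      -- the Fourier coefficients of `P`
      (∀ k : ℤ, k ≠ 0 →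
        DivConq.fourierCoef P k = (f 1 : ℂ) / Real.log 2 * DivConq.initialIntegral a b k
          + 1 / Real.log 2 * G (-(DivConq.rho a b : ℂ) - DivConq.chi k)) ∧
      (∃ c : ℂ, DivConq.HasFiniteValue G (-(DivConq.rho a b : ℂ)) c ∧
        DivConq.fourierCoef P 0 = (f 1 : ℂ) / Real.log 2 * DivConq.initialIntegral a b 0
          + (1 / Real.log 2 * c + 1 / 2)) ∧
      (∀ k : ℤ, k ≠ 0 →
        Tendsto (fun δ : ℝ =>
            1 / Real.log 2 * (∫ u in Ioi (1 : ℝ), (DivConq.extend a b g u : ℂ) /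
                (u : ℂ) ^ ((DivConq.rho a b : ℂ) + DivConq.chi k + 1 + δ))
              + (f 1 : ℂ) / Real.log 2 * DivConq.initialIntegral a b k)
          (𝓝[>] 0) (𝓝 (DivConq.fourierCoef P k))) ∧
      -- the case in which `g` is an exact power at even arguments
      ((∀ n : ℕ, 2 ≤ n → Even n → g n = (n : ℝ) ^ DivConq.rho a b) →
        ∀ n : ℕ, 1 ≤ n → Q n = 0) := by
  have hθ : 0 < min ε 1 := lt_min hε one_pos
  obtain ⟨C, hB⟩ := exists_abs_extend_sub_rpow_le ha hb hg hg₀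
  have hre : ∀ k, (-(rho a b : ℂ) - chi k).re = -rho a b := fun k => by simp [chi_re]
  have hcoef : ∀ k : ℤ, k ≠ 0 → fourierCoef (fun t => profile a b f g (2 ^ Int.fract t)) k =
      (f 1 : ℂ) / Real.log 2 * initialIntegral a b k
        + 1 / Real.log 2 * mellinCont a b g (-(rho a b : ℂ) - chi k) := by
    intro k hk
    have : -(rho a b : ℂ) - chi k + rho a b = -chi k := by ring
    rw [fourierCoef_profile ha hb hθ hB hf hg1, fourierCoef_one_sub_of_ne_zero hk, mellinCont, this]
    ring
  refine ⟨fun t => profile a b f g (2 ^ Int.fract t),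
    fun n => (n : ℝ) ^ rho a b * dyadicSum (relError a b g) (2 * n), mellinCont a b g,
    continuous_profile_two_rpow_fract ha hb hθ hB hf, fun t => by simp only [Int.fract_add_one],
    isLittleO_rpow_mul_dyadicSum hθ hB, fun n hn => ?_,
    ⟨fun s hs => ?_, meromorphicOn_mellinCont ha hb hB⟩,
    fun s hs hne => analyticAt_mellinCont ha hb hB hs hne,
    meromorphicOrderAt_mellinCont ha hb hθ hB, hcoef,
    ⟨_, hasFiniteValue_mellinCont ha hb hθ hB, ?_⟩, fun k hk => ?_, fun heven n hn => ?_⟩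
  · have hn1 : (1 : ℝ) ≤ n := by exact_mod_cast hn
    simp only [profile_two_rpow_fract ha hb hθ hB hf hn1]
    exact eq_rpow_mul_profile ha hb hn
  · have h := hasMellin_mellinCont ha hb hθ hB hs
    exact ⟨h.1, h.2.symm⟩
  · rw [fourierCoef_profile ha hb hθ hB hf hg1, fourierCoef_one_sub_zero,
      show chi 0 = 0 by simp [chi], sub_zero, add_assoc]
  · -- For `δ > 0` the integral is the continued Mellin transform at `-ρ - χ_k - δ`.
    have hne : -(rho a b : ℂ) - chi k ≠ -(rho a b : ℂ) := by simp [chi_ne_zero hk]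
    have hcont : ContinuousAt (mellinCont a b g) (-(rho a b : ℂ) - chi k) :=
      (analyticAt_mellinCont ha hb hB (by rw [hre]; linarith) hne).continuousAt
    have hpath : Tendsto (fun δ : ℝ => -(rho a b : ℂ) - chi k - δ) (𝓝[>] 0)
        (𝓝 (-(rho a b : ℂ) - chi k)) := by
      have : Continuous fun δ : ℝ => -(rho a b : ℂ) - chi k - δ := by fun_prop
      exact (this.tendsto' 0 _ (by simp)).mono_left nhdsWithin_le_nhds
    rw [hcoef k hk, add_comm ((f 1 : ℂ) / Real.log 2 * initialIntegral a b k)]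
    refine (((hcont.tendsto.comp hpath).const_mul (1 / (Real.log 2 : ℂ))).add_const _).congr' ?_
    filter_upwards [self_mem_nhdsWithin] with δ hδ
    have hs : (-(rho a b : ℂ) - chi k - δ).re < -rho a b := by
      rw [Complex.sub_re, hre, Complex.ofReal_re]
      linarith [mem_Ioi.1 hδ]
    rw [Function.comp_apply, mellinCont_eq_integral ha hb hθ hB hs
      (z := (rho a b : ℂ) + chi k + 1 + δ) (by ring)]
  · simp only [dyadicSum_relError_eq_zero ha hb heven hn, mul_zero]
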